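/- **Setting.** Fix a field $\Bbbk$ and a real polyhedral group $\mathcal Q$: a finite-dimensional real vector space, partially ordered as an abelian group so that its positive cone $\mathcal Q_+$ is an intersection of finitely many closed half-spaces, has trivial unit group, and generates $\mathcal Q$. A $\mathcal Q$-module $M$ is a family of $\Bbbk$-vector spaces $(M_q)_{q\in\mathcal Q}$ with functorial structure maps $M_q\to M_{q'}$ for $q\preceq q'$; homomorphisms are degree-preserving. $M$ is *downset-finite* if there is an injection $M\hookrightarrow\bigoplus_{j=1}^n \Bbbk[D_j]$ for finitely many downsets $D_j\subseteq\mathcal Q$, where $\Bbbk[D]$ is $\Bbbk$ in the degrees in $D$ and $0$ elsewhere, with identity maps inside $D$. For faces $\tau\subseteq\sigma$ of $\mathcal Q_+$ and $\mathbf a\in\mathcal Q$, let $(\delta_\sigma M)_{\mathbf a}=\varinjlim_{\mathbf a'\in\mathbf a-\sigma^\circ}M_{\mathbf a'}$, where $\sigma^\circ$ is the relative interior of $\sigma$. Let $\nabla_\tau$ be the set of faces containing $\tau$, ordered by reverse inclusion; then $\delta^\tau M=\bigoplus_{\sigma\in\nabla_\tau}\delta_\sigma M$ is a module over $\mathcal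 Q\times\nabla_\tau$. Let $\underline{\mathrm{Hom}}(\Bbbk[\tau],\delta^\tau M)\subseteq\delta^\tau M$ be the submodule whose component of degree $(\mathbf a,\sigma)$ consists of the images of $1$ under the homomorphisms to $\delta^\tau M$ from the skyscraper module that is $\Bbbk$ in the degrees $(\mathbf b,\sigma)$ with $\mathbf b\in\mathbf a+\tau$ and $0$ elsewhere. The *socle of $M$ along $\tau$* is the quotient-restriction $$\mathrm{soc}_\tau M=\underline{\mathrm{Hom}}(\Bbbk[\tau],\delta^\tau M)/\tau,$$ graded by $(\mathcal Q/\mathbb R\tau)\times\nabla_\tau$, obtained by identifying each homogeneous element with its images under the structure maps from degree $\mathbf a$ to degree $\mathbf a+\mathbf v$ for $\mathbf v\in\tau$. A *cogenerator of $M$ along $\tau$ with nadir $\sigma$* is a homogeneous element of $\underline{\mathrm{Hom}}(\Bbbk[\tau],\delta^\tau M)$ of degree $(\mathbf a,\sigma)$, for some $\mathbf a$, whose image in $\mathrm{soc}_\tau M$ is nonzero. An element $y\in M_{\mathbf b}$ *divides* $x\in(\delta_\sigma M)_{\mathbf a}$ if $\mathbf b\in\mathbf a-\sigma^\circ-\mathcal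 Q_+$ and the natural map $M_{\mathbf b}\to(\delta_\sigma M)_{\mathbf a}$ takes $y$ to $x$. **Theorem (Essentiality of socles).** Let $\varphi\colon M\to N$ be a homomorphism of $\mathcal Q$-modules. 1. If $\varphi$ is injective, then $\mathrm{soc}_\tau\varphi\colon\mathrm{soc}_\tau M\to\mathrm{soc}_\tau N$ is injective for all faces $\tau$ of $\mathcal Q_+$. 2. If $M$ is downset-finite and $\mathrm{soc}_\tau\varphi$ is injective for all faces $\tau$ of $\mathcal Q_+$, then $\varphi$ is injective. 3. If $M$ is downset-finite, then each nonzero homogeneous element of $M$ divides a cogenerator of $M$ along some face $\tau$ with some nadir $\sigma\supseteq\tau$. -/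

import Mathlib

noncomputable section

/-! ## Real polyhedral groups, faces, relative interiors -/

/-- A real polyhedral group: a real vector space of finite dimension, partially ordered as an
abelian group, whose positive cone `{x | 0 ≤ x}` is an intersection of finitely many closed
half-spaces and generates the group. (Antisymmetry of the order says that the positive cone has
trivial unit group. The norm only serves to fix the usual topology.) -/
class RealPolyhedralGroup (Q : Type*) [NormedAddCommGroup Q] [NormedSpace ℝ Q]
    [PartialOrder Q] : Prop extends FiniteDimensional ℝ Q, IsOrderedAddMonoid Q where
  exists_halfspaces : ∃ s : Finset (Module.Dual ℝ Q), ∀ x : Q, 0 ≤ x ↔ ∀ l ∈ s, 0 ≤ l x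
  closure_nonneg : AddSubgroup.closure {x : Q | 0 ≤ x} = ⊤

instance RealPolyhedralGroup.posSMulMono (Q : Type*) [NormedAddCommGroup Q] [NormedSpace ℝ Q]
    [PartialOrder Q] [RealPolyhedralGroup Q] : PosSMulMono ℝ Q := by
  obtain ⟨s, hs⟩ := RealPolyhedralGroup.exists_halfspaces (Q := Q)
  refine ⟨fun a ha b c hbc => ?_⟩
  rw [← sub_nonneg, ← smul_sub, hs]
  intro l hl
  rw [map_smul, smul_eq_mul]
  exact mul_nonneg ha ((hs _).1 (sub_nonneg.2 hbc) l hl)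

section Faces

variable (Q : Type*) [NormedAddCommGroup Q] [NormedSpace ℝ Q] [PartialOrder Q]
  [RealPolyhedralGroup Q]

/-- The faces of the positive cone, ordered by inclusion. The smallest face is `{0}` and the
largest face is the positive cone itself. -/
abbrev Face : Type _ :=
  {F : PointedCone ℝ Q // F.IsFaceOf (PointedCone.positive ℝ Q)}

variable {Q}

/-- The relative interior of a face. -/
def Face.relint (σ : Face Q) : Set Q := intrinsicInterior ℝ (σ.1 : Set Q)

/-- The real span of a face (which is also the subgroup generated by the face). -/
def Face.span (τ : Face Q) : Submodule ℝ Q := Submodule.span ℝ (τ.1 : Set Q)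

theorem Face.nonneg {σ : Face Q} {x : Q} (hx : x ∈ σ.1) : 0 ≤ x := σ.2.le hx

theorem Face.mem_of_le {σ : Face Q} {x y : Q} (hx : 0 ≤ x) (hxy : x ≤ y) (hy : y ∈ σ.1) :
    x ∈ σ.1 :=
  σ.2.mem_of_add_mem_left (C := PointedCone.positive ℝ Q) hx
    (show (0 : Q) ≤ y - x from sub_nonneg.2 hxy) (by simpa using hy)

theorem Face.relint_subset {σ : Face Q} {x : Q} (hx : x ∈ σ.relint) : x ∈ σ.1 :=
  intrinsicInterior_subset hx

theorem Face.relint_nonempty (σ : Face Q) : σ.relint.Nonempty :=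
  Set.Nonempty.intrinsicInterior (PointedCone.convex σ.1) ⟨0, σ.1.zero_mem⟩

theorem Face.smul_mem_relint {σ : Face Q} {x : Q} (hx : x ∈ σ.relint) {c : ℝ} (hc : 0 < c) :
    c • x ∈ σ.relint := by
  let e : Q ≃L[ℝ] Q := ContinuousLinearEquiv.smulLeft (Units.mk0 c hc.ne')
  have he : ∀ y, e y = c • y := fun y => rfl
  have h := ContinuousAffineEquiv.intrinsicInterior_image (𝕜 := ℝ) e.toContinuousAffineEquiv (σ.1 : Set Q)
  have himg : (e.toContinuousAffineEquiv '' (σ.1 : Set Q)) = (σ.1 : Set Q) := by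
    ext y
    constructor
    · rintro ⟨z, hz, rfl⟩
      exact PointedCone.smul_mem σ.1 hc.le hz
    · intro hy
      refine ⟨c⁻¹ • y, PointedCone.smul_mem σ.1 (inv_pos.2 hc).le hy, ?_⟩
      change c • c⁻¹ • y = y
      rw [smul_smul, mul_inv_cancel₀ hc.ne', one_smul]
  rw [himg] at h
  unfold Face.relint
  rw [h]
  exact ⟨x, hx, rfl⟩

theorem Face.exists_smul_le {σ : Face Q} {x y : Q} (hx : x ∈ σ.relint) (hy : y ∈ σ.1) :
    ∃ ε : ℝ, 0 < ε ∧ ε • y ≤ x := by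
  obtain ⟨x', hx', rfl⟩ := hx
  have h0 : (0 : Q) ∈ affineSpan ℝ (σ.1 : Set Q) := subset_affineSpan ℝ _ σ.1.zero_mem
  have hy' : y ∈ affineSpan ℝ (σ.1 : Set Q) := subset_affineSpan ℝ _ hy
  have hline : ∀ t : ℝ, (x' : Q) - t • y ∈ affineSpan ℝ (σ.1 : Set Q) := by
    intro t
    have := AffineSubspace.smul_vsub_vadd_mem _ (-t) hy' h0 x'.2
    simpa [sub_eq_add_neg, add_comm] using this
  let f : ℝ → affineSpan ℝ (σ.1 : Set Q) := fun t => ⟨(x' : Q) - t • y, hline t⟩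
  have hf : Continuous f := by
    refine Continuous.subtype_mk ?_ _
    fun_prop
  have hf0 : f 0 = x' := by ext; simp [f]
  have hnhds : f ⁻¹' interior ((↑) ⁻¹' (σ.1 : Set Q)) ∈ nhds (0 : ℝ) :=
    hf.continuousAt.preimage_mem_nhds (by rw [hf0]; exact isOpen_interior.mem_nhds hx')
  obtain ⟨δ, hδ, hball⟩ := Metric.mem_nhds_iff.1 hnhds
  refine ⟨δ / 2, by positivity, ?_⟩
  have hmem : (δ / 2) ∈ Metric.ball (0 : ℝ) δ := by
    rw [Metric.mem_ball, Real.dist_eq, sub_zero, abs_of_pos (by positivity)]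
    linarith
  have := interior_subset (hball hmem)
  exact sub_nonneg.1 (Face.nonneg (σ := σ) this)

/-- Every point of the relative interior of a face lies above points of the relative interior of
any smaller face. -/
theorem Face.exists_mem_relint_le {σ ρ : Face Q} (h : ρ ≤ σ) {x : Q} (hx : x ∈ σ.relint) :
    ∃ z ∈ ρ.relint, z ≤ x := by
  obtain ⟨y, hy⟩ := ρ.relint_nonempty
  obtain ⟨ε, hε, hle⟩ := Face.exists_smul_le hx (h (Face.relint_subset hy))
  exact ⟨ε • y, Face.smul_mem_relint hy hε, hle⟩

theorem Face.exists_mem_relint_le_le {σ : Face Q} {x y : Q} (hx : x ∈ σ.relint)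
    (hy : y ∈ σ.relint) : ∃ z ∈ σ.relint, z ≤ x ∧ z ≤ y := by
  obtain ⟨ε, hε, hle⟩ := Face.exists_smul_le hx (Face.relint_subset hy)
  have hy0 : 0 ≤ y := Face.nonneg (Face.relint_subset hy)
  have hm : 0 < min ε 1 := lt_min hε one_pos
  have key : ∀ c : ℝ, min ε 1 ≤ c → min ε 1 • y ≤ c • y := by
    intro c hc
    rw [← sub_nonneg, ← sub_smul]
    exact smul_nonneg (sub_nonneg.2 hc) hy0
  refine ⟨min ε 1 • y, Face.smul_mem_relint hy hm, (key ε (min_le_left _ _)).trans hle, ?_⟩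
  simpa using key 1 (min_le_right _ _)

/-- The set `a - σ°` of the degrees over which the direct limit at `(a, σ)` is taken. -/
def Face.below (σ : Face Q) (a : Q) : Set Q := {c | a - c ∈ σ.relint}

theorem Face.directedOn_below (σ : Face Q) (a : Q) : DirectedOn (· ≤ ·) (σ.below a) := by
  intro c hc d hd
  obtain ⟨z, hz, h1, h2⟩ := Face.exists_mem_relint_le_le hc hd
  refine ⟨a - z, by simpa [Face.below] using hz, ?_, ?_⟩
  · exact le_sub_comm.1 h1
  · exact le_sub_comm.1 h2

theorem Face.exists_below_le {σ ρ : Face Q} (h : ρ ≤ σ) {a b : Q} (hab : a ≤ b) {c : Q}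
    (hc : c ∈ σ.below a) : ∃ d ∈ ρ.below b, c ≤ d := by
  obtain ⟨z, hz, hle⟩ := Face.exists_mem_relint_le h hc
  exact ⟨b - z, by simpa [Face.below] using hz, (le_sub_comm.1 hle).trans (sub_le_sub_right hab z)⟩

/-- The open star of `τ`: the faces that contain `τ`, with the order opposite to inclusion. -/
abbrev OpenStar (τ : Face Q) : Type _ := (Set.Ici τ)ᵒᵈ

/-- The face `σ ⊇ τ` as an element of the open star. -/
abbrev OpenStar.mk {τ : Face Q} (σ : Face Q) (h : τ ≤ σ) : OpenStar τ :=
  OrderDual.toDual (⟨σ, h⟩ : Set.Ici τ)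

/-- The underlying face of an element of the open star. -/
abbrev OpenStar.face {τ : Face Q} (p : OpenStar τ) : Face Q := (OrderDual.ofDual p).1

end Faces

/-! ## Modules over posets -/

/-- A module over the poset `P`: a `P`-graded vector space with structure homomorphisms. -/
structure PosetModule.{u, v, w} (k : Type u) [Field k] (P : Type v) [PartialOrder P] where
  obj : P → Type w
  [addCommGroup : ∀ p, AddCommGroup (obj p)]
  [module : ∀ p, Module k (obj p)]
  map : ∀ {p q : P}, p ≤ q → obj p →ₗ[k] obj q
  map_refl : ∀ (p : P) (x : obj p), map (le_refl p) x = x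
  map_map : ∀ {p q r : P} (h : p ≤ q) (h' : q ≤ r) (x : obj p),
    map h' (map h x) = map (h.trans h') x

attribute [instance] PosetModule.addCommGroup PosetModule.module

namespace PosetModule

variable {k : Type*} [Field k] {P : Type*} [PartialOrder P]

/-- A homomorphism of modules over a poset. -/
structure Hom (M N : PosetModule k P) where
  app : ∀ p, M.obj p →ₗ[k] N.obj p
  naturality : ∀ {p q : P} (h : p ≤ q) (x : M.obj p), app q (M.map h x) = N.map h (app p x)

/-- A homomorphism of graded vector spaces is injective if it is so in each degree. -/
def Hom.Injective {M N : PosetModule k P} (φ : Hom M N) : Prop :=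
  ∀ p, Function.Injective (φ.app p)

/-- Composition of homomorphisms. -/
def Hom.comp {L M N : PosetModule k P} (ψ : Hom M N) (φ : Hom L M) : Hom L N where
  app p := ψ.app p ∘ₗ φ.app p
  naturality h x := by simp [φ.naturality, ψ.naturality]

/-- Pullback of a module along a morphism of posets. -/
def comap {P' : Type*} [PartialOrder P'] (π : P' →o P) (M : PosetModule k P) :
    PosetModule k P' where
  obj p := M.obj (π p)
  map h := M.map (π.monotone h)
  map_refl _ _ := M.map_refl _ _
  map_map _ _ _ := M.map_map _ _ _

/-- Pullback of a homomorphism along a morphism of posets. -/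
def Hom.comap {P' : Type*} [PartialOrder P'] (π : P' →o P) {M N : PosetModule k P}
    (φ : Hom M N) : Hom (M.comap π) (N.comap π) where
  app p := φ.app (π p)
  naturality h x := φ.naturality (π.monotone h) x

/-- The downset module `k[D]`: it is `k` in the degrees in `D` and `0` in all other degrees
(a function on the proofs of `q ∈ D` with values in `k`), with identity maps inside `D`. -/
def downset (k : Type*) [Field k] (D : LowerSet P) : PosetModule k P where
  obj q := PLift (q ∈ D) → k
  map h := { toFun := fun f hq => f ⟨D.lower h hq.down⟩
             map_add' := fun _ _ => rfl
             map_smul' := fun _ _ => rfl }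
  map_refl _ _ := rfl
  map_map _ _ _ := rfl

/-- The direct sum of finitely many modules. -/
def directSum {n : ℕ} (E : Fin n → PosetModule k P) : PosetModule k P where
  obj q := ∀ j, (E j).obj q
  map h := LinearMap.pi fun j => (E j).map h ∘ₗ LinearMap.proj j
  map_refl q x := by funext j; exact (E j).map_refl q (x j)
  map_map h h' x := by funext j; exact (E j).map_map h h' (x j)

/-- A module is downset-finite if it embeds into a finite direct sum of downset modules. -/
def DownsetFinite (M : PosetModule k P) : Prop :=
  ∃ (n : ℕ) (D : Fin n → LowerSet P) (ι : Hom M (directSum fun j => downset k (D j))),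
    ι.Injective

/-! ### Direct limits over sets of degrees -/

open Classical in
/-- The direct limit of the components of `M` in the degrees that lie in `S`. -/
abbrev Colim (M : PosetModule k P) (S : Set P) : Type _ :=
  Module.DirectLimit (R := k) (fun c : S => M.obj c)
    (fun c d (h : c ≤ d) => M.map (show (c : P) ≤ d from h))

open Classical in
/-- The canonical map from a component to the direct limit. -/
def toColim (M : PosetModule k P) (S : Set P) {c : P} (hc : c ∈ S) : M.obj c →ₗ[k] M.Colim S :=
  Module.DirectLimit.of k S (fun c : S => M.obj c)
    (fun c d (h : c ≤ d) => M.map (show (c : P) ≤ d from h)) ⟨c, hc⟩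

theorem toColim_map (M : PosetModule k P) (S : Set P) {c d : P} (hc : c ∈ S) (hd : d ∈ S)
    (h : c ≤ d) (x : M.obj c) : M.toColim S hd (M.map h x) = M.toColim S hc x := by
  classical
  exact Module.DirectLimit.of_f (R := k) (ι := S) (i := ⟨c, hc⟩) (j := ⟨d, hd⟩) (hij := h)

open Classical in
/-- The universal property of the direct limit. -/
def colimLift (M : PosetModule k P) (S : Set P) {V : Type*} [AddCommGroup V] [Module k V]
    (g : ∀ c : P, c ∈ S → (M.obj c →ₗ[k] V))
    (hg : ∀ (c d : P) (hc : c ∈ S) (hd : d ∈ S) (h : c ≤ d) (x : M.obj c),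
      g d hd (M.map h x) = g c hc x) : M.Colim S →ₗ[k] V :=
  Module.DirectLimit.lift k S _ _ (fun c : S => g c c.2)
    (fun c d h x => hg c d c.2 d.2 h x)

theorem colimLift_toColim (M : PosetModule k P) (S : Set P) {V : Type*} [AddCommGroup V]
    [Module k V] (g : ∀ c : P, c ∈ S → (M.obj c →ₗ[k] V))
    (hg : ∀ (c d : P) (hc : c ∈ S) (hd : d ∈ S) (h : c ≤ d) (x : M.obj c),
      g d hd (M.map h x) = g c hc x) {c : P} (hc : c ∈ S) (x : M.obj c) :
    M.colimLift S g hg (M.toColim S hc x) = g c hc x := by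
  classical
  exact Module.DirectLimit.lift_of (R := k) (ι := S) (G := fun c : S => M.obj c)
    (fun c : S => g c c.2) (fun c d h x => hg c d c.2 d.2 h x) (i := ⟨c, hc⟩) x

theorem colim_hom_ext (M : PosetModule k P) (S : Set P) {V : Type*} [AddCommGroup V]
    [Module k V] {f g : M.Colim S →ₗ[k] V}
    (h : ∀ (c : P) (hc : c ∈ S) (x : M.obj c), f (M.toColim S hc x) = g (M.toColim S hc x)) :
    f = g := by
  classical
  refine Module.DirectLimit.hom_ext fun i => ?_
  ext x
  exact h i i.2 x

/-- If `T` is directed then the images in the direct limit over `T` of an element of degree `c`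
do not depend on the degree in `T` that the element is first moved to. -/
theorem toColim_map_eq (M : PosetModule k P) {T : Set P} (hT : DirectedOn (· ≤ ·) T)
    {c d d' : P} (hd : d ∈ T) (hd' : d' ∈ T) (h : c ≤ d) (h' : c ≤ d') (x : M.obj c) :
    M.toColim T hd (M.map h x) = M.toColim T hd' (M.map h' x) := by
  obtain ⟨e, he, hde, hde'⟩ := hT d hd d' hd'
  rw [← M.toColim_map T hd he hde, ← M.toColim_map T hd' he hde', M.map_map, M.map_map]

/-- The natural map between direct limits over `S` and `T` when `T` is directed and each element
of `S` lies below some element of `T`. -/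
def colimMap (M : PosetModule k P) {S T : Set P} (hT : DirectedOn (· ≤ ·) T)
    (hST : ∀ c ∈ S, ∃ d ∈ T, c ≤ d) : M.Colim S →ₗ[k] M.Colim T :=
  M.colimLift S
    (fun c hc => M.toColim T (hST c hc).choose_spec.1 ∘ₗ M.map (hST c hc).choose_spec.2)
    (fun c d hc hd h x => by
      simp only [LinearMap.comp_apply, M.map_map]
      exact M.toColim_map_eq hT _ _ _ _ x)

theorem colimMap_toColim (M : PosetModule k P) {S T : Set P} (hT : DirectedOn (· ≤ ·) T)
    (hST : ∀ c ∈ S, ∃ d ∈ T, c ≤ d) {c d : P} (hc : c ∈ S) (hd : d ∈ T) (h : c ≤ d)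
    (x : M.obj c) :
    M.colimMap hT hST (M.toColim S hc x) = M.toColim T hd (M.map h x) := by
  rw [colimMap, colimLift_toColim]
  exact M.toColim_map_eq hT _ _ _ _ x

/-- The map that a homomorphism induces between direct limits. -/
def Hom.colim {M N : PosetModule k P} (φ : Hom M N) (S : Set P) : M.Colim S →ₗ[k] N.Colim S :=
  M.colimLift S (fun c hc => N.toColim S hc ∘ₗ φ.app c)
    (fun c d hc hd h x => by
      simp only [LinearMap.comp_apply, φ.naturality, N.toColim_map S hc hd h])

theorem Hom.colim_toColim {M N : PosetModule k P} (φ : Hom M N) (S : Set P) {c : P} (hc : c ∈ S)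
    (x : M.obj c) : φ.colim S (M.toColim S hc x) = N.toColim S hc (φ.app c x) := by
  rw [Hom.colim, colimLift_toColim]
  rfl

theorem colimMap_refl (M : PosetModule k P) {S : Set P} (hS : DirectedOn (· ≤ ·) S)
    (h : ∀ c ∈ S, ∃ d ∈ S, c ≤ d) (z : M.Colim S) : M.colimMap hS h z = z := by
  refine LinearMap.congr_fun (f := M.colimMap hS h) (g := LinearMap.id)
    (M.colim_hom_ext _ fun c hc y => ?_) z
  rw [M.colimMap_toColim hS h hc hc le_rfl, M.map_refl]
  rfl

theorem colimMap_colimMap (M : PosetModule k P) {S T U : Set P} (hT : DirectedOn (· ≤ ·) T)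
    (hU : DirectedOn (· ≤ ·) U) (hST : ∀ c ∈ S, ∃ d ∈ T, c ≤ d) (hTU : ∀ c ∈ T, ∃ d ∈ U, c ≤ d)
    (hSU : ∀ c ∈ S, ∃ d ∈ U, c ≤ d) (z : M.Colim S) :
    M.colimMap hU hTU (M.colimMap hT hST z) = M.colimMap hU hSU z := by
  refine LinearMap.congr_fun (f := M.colimMap hU hTU ∘ₗ M.colimMap hT hST)
    (g := M.colimMap hU hSU) (M.colim_hom_ext _ fun c hc u => ?_) z
  obtain ⟨d, hd, hcd⟩ := hST c hc
  obtain ⟨e, he, hde⟩ := hTU d hd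
  rw [LinearMap.comp_apply, M.colimMap_toColim hT hST hc hd hcd,
    M.colimMap_toColim hU hTU hd he hde, M.colimMap_toColim hU hSU hc he (hcd.trans hde),
    M.map_map]

theorem Hom.colim_colimMap {M N : PosetModule k P} (φ : Hom M N) {S T : Set P}
    (hT : DirectedOn (· ≤ ·) T) (hST : ∀ c ∈ S, ∃ d ∈ T, c ≤ d) (z : M.Colim S) :
    φ.colim T (M.colimMap hT hST z) = N.colimMap hT hST (φ.colim S z) := by
  refine LinearMap.congr_fun (f := φ.colim T ∘ₗ M.colimMap hT hST)
    (g := N.colimMap hT hST ∘ₗ φ.colim S) (M.colim_hom_ext _ fun c hc u => ?_) z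
  obtain ⟨d, hd, hcd⟩ := hST c hc
  rw [LinearMap.comp_apply, LinearMap.comp_apply, M.colimMap_toColim hT hST hc hd hcd,
    φ.colim_toColim, φ.colim_toColim, N.colimMap_toColim hT hST hc hd hcd, φ.naturality]

/-! ### Upper boundaries -/

variable {Q : Type*} [NormedAddCommGroup Q] [NormedSpace ℝ Q] [PartialOrder Q]
  [RealPolyhedralGroup Q]

/-- The upper boundary `δM`, a module over `Q × F` where `F` is the face poset with the order
opposite to inclusion. Its component at `(a, σ)` is the direct limit of the vector spaces `M_c`
over `c ∈ a - σ°`. -/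
def upperBoundary (M : PosetModule k Q) : PosetModule k (Q × (Face Q)ᵒᵈ) where
  obj x := M.Colim ((OrderDual.ofDual x.2).below x.1)
  map {_ y} h := M.colimMap ((OrderDual.ofDual y.2).directedOn_below y.1)
    (fun _ hc => Face.exists_below_le (OrderDual.ofDual_le_ofDual.2 h.2) h.1 hc)
  map_refl _ z := M.colimMap_refl _ _ z
  map_map _ _ z := M.colimMap_colimMap _ _ _ _ _ z

/-- The upper boundary functor on homomorphisms. -/
def Hom.upperBoundary {M N : PosetModule k Q} (φ : Hom M N) :
    Hom M.upperBoundary N.upperBoundary where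
  app x := φ.colim ((OrderDual.ofDual x.2).below x.1)
  naturality {_ y} h z := φ.colim_colimMap ((OrderDual.ofDual y.2).directedOn_below y.1)
    (fun _ hc => Face.exists_below_le (OrderDual.ofDual_le_ofDual.2 h.2) h.1 hc) z

/-- The inclusion of `Q × (open star of τ)` into `Q × (face poset)`. -/
def starInclusion (τ : Face Q) : (Q × OpenStar τ) →o (Q × (Face Q)ᵒᵈ) where
  toFun x := (x.1, OrderDual.toDual x.2.face)
  monotone' _ _ h := h

/-- The upper boundary along `τ`: the components of `δM` at the faces that contain `τ`. -/
def upperBoundaryAlong (τ : Face Q) (M : PosetModule k Q) : PosetModule k (Q × OpenStar τ) :=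
  M.upperBoundary.comap (starInclusion τ)

/-- The upper boundary functor along `τ` on homomorphisms. -/
def Hom.upperBoundaryAlong (τ : Face Q) {M N : PosetModule k Q} (φ : Hom M N) :
    Hom (M.upperBoundaryAlong τ) (N.upperBoundaryAlong τ) :=
  φ.upperBoundary.comap (starInclusion τ)

/-- A homogeneous element `y` of degree `b` divides the element `x` of the upper boundary of `M`
atop `σ` at `a`: the degree `b` lies in `a - σ° - Q₊`, that is `b ≤ c` for some `c ∈ a - σ°`,
and the natural map `M_b → M_c → (δ_σ M)_a` takes `y` to `x`. (The natural map does not depend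
on `c`, by `toColim_map_eq`.) -/
def Divides (M : PosetModule k Q) {b : Q} (y : M.obj b) {τ : Face Q} {a : Q} {σ : OpenStar τ}
    (x : (M.upperBoundaryAlong τ).obj (a, σ)) : Prop :=
  ∃ (c : Q) (hc : c ∈ σ.face.below a) (h : b ≤ c),
    M.toColim (σ.face.below a) hc (M.map h y) = x

/-! ### Socles along a face -/

open Classical in
/-- The skyscraper `k[a + τ] ⊗ k_p` at `(a, p)` along `τ`: it is `k` in the degrees `(b, p)` with
`b ∈ a + τ`, with identity maps between them, and `0` in all other degrees. -/
def skyscraper (k : Type*) [Field k] (τ : Face Q) (a : Q) (p : P) : PosetModule k (Q × P) where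
  obj x := PLift (x.1 - a ∈ τ.1 ∧ x.2 = p) → k
  map {x _} _ :=
    { toFun := fun f _ => if hx : x.1 - a ∈ τ.1 ∧ x.2 = p then f ⟨hx⟩ else 0
      map_add' := fun f g => by
        funext _
        by_cases hx : x.1 - a ∈ τ.1 ∧ x.2 = p <;> simp [hx]
      map_smul' := fun c f => by
        funext _
        by_cases hx : x.1 - a ∈ τ.1 ∧ x.2 = p <;> simp [hx] }
  map_refl x f := by
    funext hx
    simp [hx.down]
  map_map {x y z} h h' f := by
    funext hz
    by_cases hx : x.1 - a ∈ τ.1 ∧ x.2 = p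
    · have hy : y.1 - a ∈ τ.1 ∧ y.2 = p := by
        refine ⟨Face.mem_of_le ?_ (sub_le_sub_right h'.1 a) hz.down.1, ?_⟩
        · exact (Face.nonneg hx.1).trans (sub_le_sub_right h.1 a)
        · exact le_antisymm (h'.2.trans hz.down.2.le) (hx.2 ▸ h.2)
      simp [hx, hy]
    · simp [hx]

/-- The generator `1` of the skyscraper, in degree `(a, p)`. -/
def skyscraperOne (k : Type*) [Field k] (τ : Face Q) (a : Q) (p : P) :
    (skyscraper k τ a p).obj (a, p) := fun _ => 1

theorem skyscraper_map_apply (τ : Face Q) (a : Q) (p : P) {x y : Q × P} (h : x ≤ y)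
    (f : (skyscraper k τ a p).obj x) (hx : x.1 - a ∈ τ.1 ∧ x.2 = p)
    (hy : y.1 - a ∈ τ.1 ∧ y.2 = p) : (skyscraper k τ a p).map h f ⟨hy⟩ = f ⟨hx⟩ :=
  dif_pos hx

theorem skyscraper_map_eq_zero (τ : Face Q) (a : Q) (p : P) {x y : Q × P} (h : x ≤ y)
    (f : (skyscraper k τ a p).obj x) (hx : ¬(x.1 - a ∈ τ.1 ∧ x.2 = p)) :
    (skyscraper k τ a p).map h f = 0 :=
  funext fun _ => dif_neg hx

theorem exists_hom_skyscraper_iff (τ : Face Q) (N : PosetModule k (Q × P)) (x : Q × P)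
    (n : N.obj x) :
    (∃ f : Hom (skyscraper k τ x.1 x.2) N, f.app x (skyscraperOne k τ x.1 x.2) = n) ↔
      ∀ (y : Q × P) (h : x ≤ y), ¬(y.1 - x.1 ∈ τ.1 ∧ y.2 = x.2) → N.map h n = 0 := by
  classical
  constructor
  · rintro ⟨f, rfl⟩ y h hy
    rw [← f.naturality]
    have : (skyscraper k τ x.1 x.2).map h (skyscraperOne k τ x.1 x.2) = 0 := by
      funext hy'
      exact absurd hy'.down hy
    rw [this, map_zero]
  · intro hn
    have hle : ∀ y : Q × P, y.1 - x.1 ∈ τ.1 ∧ y.2 = x.2 → x ≤ y := fun y hy =>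
      ⟨sub_nonneg.1 (Face.nonneg hy.1), hy.2.ge⟩
    refine ⟨⟨fun y =>
      { toFun := fun v => if hy : y.1 - x.1 ∈ τ.1 ∧ y.2 = x.2 then
          v ⟨hy⟩ • N.map (hle y hy) n else 0
        map_add' := fun v w => by
          by_cases hy : y.1 - x.1 ∈ τ.1 ∧ y.2 = x.2
          · simp only [dif_pos hy]
            exact add_smul (v ⟨hy⟩) (w ⟨hy⟩) _
          · simp only [dif_neg hy, add_zero]
        map_smul' := fun c v => by
          by_cases hy : y.1 - x.1 ∈ τ.1 ∧ y.2 = x.2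
          · simp only [dif_pos hy]
            exact mul_smul c (v ⟨hy⟩) _
          · simp only [dif_neg hy, smul_zero] }, ?_⟩, ?_⟩
    · intro y z h v
      simp only [LinearMap.coe_mk, AddHom.coe_mk]
      by_cases hy : y.1 - x.1 ∈ τ.1 ∧ y.2 = x.2
      · by_cases hz : z.1 - x.1 ∈ τ.1 ∧ z.2 = x.2
        · rw [dif_pos hy, dif_pos hz, map_smul, N.map_map,
            skyscraper_map_apply τ x.1 x.2 h v hy hz]
        · rw [dif_pos hy, dif_neg hz, map_smul, N.map_map, hn z ((hle y hy).trans h) hz, smul_zero]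
      · rw [dif_neg hy, map_zero, skyscraper_map_eq_zero τ x.1 x.2 h v hy]
        split_ifs with hz
        · exact zero_smul k _
        · rfl
    · simp [skyscraperOne, N.map_refl, τ.1.zero_mem]

/-- The module `Hom(k[τ], N)`, whose component at `(a, p)` is the space of homomorphisms to `N`
from the skyscraper at `(a, p)` along `τ`, regarded as a submodule of `N` via `f ↦ f 1`. -/
def homSkyscraper (τ : Face Q) (N : PosetModule k (Q × P)) : PosetModule k (Q × P) where
  obj x := ({ carrier := {n | ∃ f : Hom (skyscraper k τ x.1 x.2) N,
                f.app x (skyscraperOne k τ x.1 x.2) = n}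
              add_mem' := fun {m n} hm hn => by
                simp only [Set.mem_ofPred_eq, exists_hom_skyscraper_iff] at hm hn ⊢
                intro y h hy
                rw [map_add, hm y h hy, hn y h hy, add_zero]
              zero_mem' := by
                simp only [Set.mem_ofPred_eq, exists_hom_skyscraper_iff, map_zero, implies_true]
              smul_mem' := fun c n hn => by
                simp only [Set.mem_ofPred_eq, exists_hom_skyscraper_iff] at hn ⊢
                intro y h hy
                rw [map_smul, hn y h hy, smul_zero] } : Submodule k (N.obj x))
  map {x y} h := (N.map h).restrict (fun n hn => by
    change ∃ f : Hom (skyscraper k τ x.1 x.2) N,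
      f.app x (skyscraperOne k τ x.1 x.2) = n at hn
    change ∃ f : Hom (skyscraper k τ y.1 y.2) N,
      f.app y (skyscraperOne k τ y.1 y.2) = N.map h n
    rw [exists_hom_skyscraper_iff] at hn ⊢
    intro z hz hzy
    rw [N.map_map]
    refine hn z (h.trans hz) fun hzx => hzy ⟨?_, ?_⟩
    · exact Face.mem_of_le (sub_nonneg.2 hz.1) (sub_le_sub_left h.1 z.1) hzx.1
    · exact le_antisymm (hzx.2.le.trans h.2) hz.2)
  map_refl x n := Subtype.ext (N.map_refl x n.1)
  map_map h h' n := Subtype.ext (N.map_map h h' n.1)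

/-- The functor `Hom(k[τ], -)` on homomorphisms. -/
def Hom.homSkyscraper (τ : Face Q) {M N : PosetModule k (Q × P)} (φ : Hom M N) :
    Hom (M.homSkyscraper τ) (N.homSkyscraper τ) where
  app x := (φ.app x).restrict (fun m hm => by
    obtain ⟨f, rfl⟩ := hm
    exact ⟨φ.comp f, rfl⟩)
  naturality h m := Subtype.ext (φ.naturality h m.1)

/-- The degrees `(a, p)` such that `a` maps to `α` in `Q / ℝτ`. -/
def fiber (τ : Face Q) (α : Q ⧸ τ.span) (p : P) : Set (Q × P) :=
  {x | Submodule.Quotient.mk x.1 = α ∧ x.2 = p}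

/-- The component in degree `(α, p)`, for `α ∈ Q / ℝτ`, of the quotient-restriction `N / τ` of
`N` along `τ`, which is the quotient of `N` that identifies each homogeneous element with its
translates along `τ`: the direct sum of the `N_(a,p)` with `a ∈ α`, modulo the relations that
identify `x ∈ N_(a,p)` with its image in `N_(a',p)` whenever `a' - a ∈ τ`, that is `a ≤ a'`.
This is the direct limit of the `N_(a,p)` over `a ∈ α`. -/
abbrev QuotientRestriction (τ : Face Q) (N : PosetModule k (Q × P)) (α : Q ⧸ τ.span) (p : P) :
    Type _ :=
  N.Colim (fiber τ α p)

/-- The socle of `M` along `τ`, that is `Hom(k[τ], δ^τ M) / τ`, as a vector space graded by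
`Q / ℝτ` and by the faces `σ` that contain `τ`. -/
abbrev Socle (τ : Face Q) (M : PosetModule k Q) (α : Q ⧸ τ.span) (σ : OpenStar τ) : Type _ :=
  QuotientRestriction τ ((M.upperBoundaryAlong τ).homSkyscraper τ) α σ

/-- The map that a homomorphism induces between socles along `τ`, in each degree. -/
def Hom.socle (τ : Face Q) {M N : PosetModule k Q} (φ : Hom M N) (α : Q ⧸ τ.span)
    (σ : OpenStar τ) : Socle τ M α σ →ₗ[k] Socle τ N α σ :=
  ((φ.upperBoundaryAlong τ).homSkyscraper τ).colim (fiber τ α σ)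

/-- The map between the socles along `τ` is injective (as a map of graded vector spaces). -/
def Hom.SocleInjective (τ : Face Q) {M N : PosetModule k Q} (φ : Hom M N) : Prop :=
  ∀ (α : Q ⧸ τ.span) (σ : OpenStar τ), Function.Injective (φ.socle τ α σ)

/-- A cogenerator of `M` along `τ` with nadir `σ`, in degree `a`: an element of
`Hom(k[τ], δ^τ M)` of degree `(a, σ)` whose image in the socle of `M` along `τ` is nonzero. -/
def IsCogenerator (M : PosetModule k Q) {τ : Face Q} {a : Q} {σ : OpenStar τ}
    (s : (M.upperBoundaryAlong τ).obj (a, σ)) : Prop :=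
  ∃ hs : ∃ f : Hom (skyscraper k τ a σ) (M.upperBoundaryAlong τ),
      f.app (a, σ) (skyscraperOne k τ a σ) = s,
    ((M.upperBoundaryAlong τ).homSkyscraper τ).toColim
      (fiber τ (Submodule.Quotient.mk a) σ) (c := (a, σ)) ⟨rfl, rfl⟩ ⟨s, hs⟩ ≠ 0

end PosetModule

end

noncomputable section

open Filter Topology

/-! ## Faces of the positive cone -/

section Faces

variable {Q : Type*} [NormedAddCommGroup Q] [NormedSpace ℝ Q] [PartialOrder Q]
  [RealPolyhedralGroup Q]

/-! Socles preserve injections because the upper boundary and the quotient-restriction are limits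
over directed sets, hence exact, and Hom is left exact. Conversely, a nonzero element killed by `φ`
would divide a cogenerator whose class in the socle `φ` also kills. So everything rests on the
divisibility statement.

Let `y ≠ 0` have degree `b`. Downset-finiteness gives a downset `D` such that `y` survives in a
degree `c ≥ b` exactly when `c ∈ D`. Hence the image of `y` atop `σ` at `a` is nonzero exactly when
`a - σ° ⊆ D`, and only the geometry of `D` matters (`Face.exists_nadir`).

Let `F c` be the set of faces `τ` with `c + τ ⊆ D`. It shrinks as `c` grows and there are finitely
many faces, so after moving `b` up to some `b'` it is constant on `W = D ∩ (b' + Q₊)`. Take `τ`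
maximal in `F b'`. Modulo `ℝτ` the set `W` is bounded, since an escaping sequence would produce a
ray in `W` that enlarges `τ` (`Face.isBounded_image_coords`). Compactness then gives a degree `a`
that is maximal in the closure of `W` up to `τ` (`Face.exists_maximal_mem_closure`). It need not lie
in `D`, but `a - σ° ⊆ D` for the face `σ` generated by `a - b'`, and a minimal face of this kind
containing `τ` is the nadir. Maximality of `a` and minimality of `σ` kill `y` under every move out
of `a + τ` or to a smaller face; constancy of `F` keeps it alive along `τ`. -/

/-- The smallest face that contains the nonnegative vector `p`. -/
def Face.generatedBy (p : Q) (hp : 0 ≤ p) : Face Q :=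
  ⟨{ carrier := {x | 0 ≤ x ∧ ∃ r : ℝ, 0 < r ∧ x ≤ r • p}
     add_mem' := by
      rintro x y ⟨hx, r, hr, hxr⟩ ⟨hy, r', hr', hyr⟩
      exact ⟨add_nonneg hx hy, r + r', add_pos hr hr', by
        rw [add_smul]; exact add_le_add hxr hyr⟩
     zero_mem' := ⟨le_rfl, 1, one_pos, by simpa using hp⟩
     smul_mem' := by
      rintro ⟨c, hc⟩ x ⟨hx, r, hr, hxr⟩
      refine ⟨show 0 ≤ c • x from smul_nonneg hc hx, c * r + 1, by positivity, ?_⟩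
      change c • x ≤ (c * r + 1) • p
      rw [add_smul, one_smul, mul_smul]
      exact le_add_of_le_of_nonneg (smul_le_smul_of_nonneg_left hxr hc) hp },
   ⟨fun x hx => hx.1, by
      rintro x y c hx hy hc ⟨-, r, hr, hle⟩
      refine ⟨hx, c⁻¹ * r, by positivity, ?_⟩
      have h : c • x ≤ r • p := (le_add_of_nonneg_right (show (0 : Q) ≤ y from hy)).trans hle
      have := smul_le_smul_of_nonneg_left h (inv_pos.2 hc).le
      rwa [smul_smul, smul_smul, inv_mul_cancel₀ hc.ne', one_smul] at this⟩⟩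

theorem Face.self_mem_generatedBy {p : Q} (hp : 0 ≤ p) : p ∈ (Face.generatedBy p hp).1 :=
  ⟨hp, 1, one_pos, by rw [one_smul]⟩

theorem Face.le_generatedBy {τ : Face Q} {t p : Q} (ht : t ∈ τ.relint) (hp : 0 ≤ p)
    (htp : t ∈ (Face.generatedBy p hp).1) : τ ≤ Face.generatedBy p hp := by
  intro x hx
  obtain ⟨ε, hε, hle⟩ := Face.exists_smul_le ht hx
  have h : ε⁻¹ • ε • x ∈ (Face.generatedBy p hp).1 :=
    PointedCone.smul_mem _ (inv_pos.2 hε).le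
      (Face.mem_of_le (smul_nonneg hε.le (Face.nonneg hx)) hle htp)
  rwa [smul_smul, inv_mul_cancel₀ hε.ne', one_smul] at h

/-- Scaling a relative interior point brings it below `p`. This lets limits over `a - ρ°` be tested
only at degrees above a fixed lower bound. -/
theorem Face.exists_mem_relint_le_of_le_generatedBy {p : Q} {hp : 0 ≤ p} {ρ : Face Q}
    (h : ρ ≤ Face.generatedBy p hp) {z : Q} (hz : z ∈ ρ.relint) :
    ∃ z' ∈ ρ.relint, z' ≤ z ∧ z' ≤ p := by
  obtain ⟨-, r, hr, hle⟩ := h (Face.relint_subset hz)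
  obtain ⟨z', hz', h1, h2⟩ :=
    Face.exists_mem_relint_le_le hz (Face.smul_mem_relint hz (inv_pos.2 hr))
  refine ⟨z', hz', h1, h2.trans ?_⟩
  have := smul_le_smul_of_nonneg_left hle (inv_pos.2 hr).le
  rwa [smul_smul, inv_mul_cancel₀ hr.ne', one_smul] at this

/-! ### Faces in terms of the defining functionals -/

section Halfspaces

variable {s : Finset (Module.Dual ℝ Q)}

/-- A large multiple of `t` repairs every functional that is positive at `t`, so only those
vanishing at `t` need checking. -/
theorem eventually_nonneg_add_smul (hs : ∀ x : Q, 0 ≤ x ↔ ∀ l ∈ s, 0 ≤ l x) {t y : Q}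
    (ht : 0 ≤ t) (h : ∀ l ∈ s, l t = 0 → 0 ≤ l y) : ∀ᶠ r : ℝ in atTop, 0 ≤ y + r • t := by
  simp only [hs (_ + _)]
  rw [eventually_all_finset]
  intro l hl
  rcases ((hs t).1 ht l hl).eq_or_lt with h0 | h0
  · exact Eventually.of_forall fun r => by simpa [← h0] using h l hl h0.symm
  · filter_upwards [eventually_ge_atTop (-(l y) / l t)] with r hr
    rw [div_le_iff₀ h0] at hr
    simp only [map_add, map_smul, smul_eq_mul]
    linarith

theorem Face.eq_zero_of_mem_relint (hs : ∀ x : Q, 0 ≤ x ↔ ∀ l ∈ s, 0 ≤ l x) {τ : Face Q}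
    {t x : Q} (ht : t ∈ τ.relint) (hx : x ∈ τ.1) {l : Module.Dual ℝ Q} (hl : l ∈ s)
    (h : l t = 0) : l x = 0 := by
  obtain ⟨ε, hε, hle⟩ := Face.exists_smul_le ht hx
  have h1 := (hs _).1 (sub_nonneg.2 hle) l hl
  have h2 := (hs _).1 (Face.nonneg hx) l hl
  rw [map_sub, map_smul, h, smul_eq_mul] at h1
  nlinarith

theorem Face.mem_of_forall_eq_zero (hs : ∀ x : Q, 0 ≤ x ↔ ∀ l ∈ s, 0 ≤ l x) {τ : Face Q}
    {t x : Q} (ht : t ∈ τ.1) (hx : 0 ≤ x) (h : ∀ l ∈ s, l t = 0 → l x = 0) : x ∈ τ.1 := by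
  obtain ⟨r, hr, hr0⟩ := ((eventually_nonneg_add_smul hs (y := -x) (Face.nonneg ht)
    fun l hl h0 => by simp [h l hl h0]).and (eventually_ge_atTop 0)).exists
  refine Face.mem_of_le hx (y := r • t) ?_ (PointedCone.smul_mem τ.1 hr0 ht)
  rwa [neg_add_eq_sub, sub_nonneg] at hr

end Halfspaces

/-! ### Finiteness of the set of faces, and spans of faces -/

/-- A face is determined by which of the finitely many defining functionals vanish on it. -/
instance Face.finite : Finite (Face Q) := by
  obtain ⟨s, hs⟩ := RealPolyhedralGroup.exists_halfspaces (Q := Q)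
  have key : ∀ τ τ' : Face Q, (∀ l ∈ s, (∀ x ∈ τ'.1, l x = 0) → ∀ x ∈ τ.1, l x = 0) → τ ≤ τ' := by
    intro τ τ' h x hx
    obtain ⟨t, ht⟩ := τ'.relint_nonempty
    exact Face.mem_of_forall_eq_zero hs (Face.relint_subset ht) (Face.nonneg hx) fun l hl h0 =>
      h l hl (fun y hy => Face.eq_zero_of_mem_relint hs ht hy hl h0) x hx
  refine Finite.of_injective (fun τ : Face Q => {l : s | ∀ x ∈ τ.1, l.1 x = 0}) ?_
  intro τ τ' h
  have h' : ∀ l ∈ s, (∀ x ∈ τ.1, l x = 0) ↔ ∀ x ∈ τ'.1, l x = 0 := fun l hl =>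
    Set.ext_iff.1 h ⟨l, hl⟩
  exact le_antisymm (key _ _ fun l hl => (h' l hl).2) (key _ _ fun l hl => (h' l hl).1)

theorem Face.exists_sub_of_mem_span {τ : Face Q} {x : Q} (hx : x ∈ τ.span) :
    ∃ u ∈ τ.1, ∃ v ∈ τ.1, x = u - v := by
  refine Submodule.span_induction (p := fun x _ => ∃ u ∈ τ.1, ∃ v ∈ τ.1, x = u - v)
    ?_ ?_ ?_ ?_ hx
  · exact fun x hx => ⟨x, hx, 0, τ.1.zero_mem, by simp⟩
  · exact ⟨0, τ.1.zero_mem, 0, τ.1.zero_mem, by simp⟩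
  · rintro _ _ - - ⟨u, hu, v, hv, rfl⟩ ⟨u', hu', v', hv', rfl⟩
    exact ⟨u + u', τ.1.add_mem hu hu', v + v', τ.1.add_mem hv hv', by abel⟩
  · rintro c _ - ⟨u, hu, v, hv, rfl⟩
    rcases le_total 0 c with hc | hc
    · exact ⟨c • u, PointedCone.smul_mem τ.1 hc hu, c • v, PointedCone.smul_mem τ.1 hc hv,
        smul_sub _ _ _⟩
    · refine ⟨(-c) • v, PointedCone.smul_mem τ.1 (neg_nonneg.2 hc) hv, (-c) • u,
        PointedCone.smul_mem τ.1 (neg_nonneg.2 hc) hu, ?_⟩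
      rw [smul_sub, neg_smul, neg_smul]
      abel

theorem Face.mem_of_mem_span {τ : Face Q} {x : Q} (hx : x ∈ τ.span) (h0 : 0 ≤ x) : x ∈ τ.1 := by
  obtain ⟨u, hu, v, hv, rfl⟩ := Face.exists_sub_of_mem_span hx
  exact Face.mem_of_le h0 (sub_le_self u (Face.nonneg hv)) hu

/-! ### Coordinates modulo a face, boundedness and maximal degrees -/

/-- The functionals in `s` that vanish on the face `τ`. -/
abbrev Face.vanishing (s : Finset (Module.Dual ℝ Q)) (τ : Face Q) : Type _ :=
  {l : s // ∀ x ∈ τ.1, l.1 x = 0}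

/-- The linear map whose coordinates are the functionals in `s` that vanish on the face `τ`. -/
def Face.coords (s : Finset (Module.Dual ℝ Q)) (τ : Face Q) : Q →ₗ[ℝ] (τ.vanishing s → ℝ) :=
  LinearMap.pi fun l => l.1.1

theorem Face.coords_apply (s : Finset (Module.Dual ℝ Q)) (τ : Face Q) (x : Q)
    (l : τ.vanishing s) : τ.coords s x l = l.1.1 x := rfl

theorem Face.coords_eq_zero (s : Finset (Module.Dual ℝ Q)) {τ : Face Q} {x : Q} (hx : x ∈ τ.1) :
    τ.coords s x = 0 := funext fun l => l.2 x hx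

theorem Face.isClosed_range_coords (s : Finset (Module.Dual ℝ Q)) (τ : Face Q) :
    IsClosed (LinearMap.range (τ.coords s) : Set (τ.vanishing s → ℝ)) :=
  Submodule.closed_of_finiteDimensional _

/-- If the coordinates escaped to infinity, normalizing them and passing to a limit would give a
nonzero direction modulo `τ` whose ray from `b` stays in `W`, against `hmax`. -/
theorem Face.isBounded_image_coords {s : Finset (Module.Dual ℝ Q)}
    (hs : ∀ x : Q, 0 ≤ x ↔ ∀ l ∈ s, 0 ≤ l x) {τ : Face Q} {W : Set Q} {b : Q}
    (hb : ∀ w ∈ W, b ≤ w) (hW : ∀ x, ∀ w ∈ W, b ≤ x → x ≤ w → x ∈ W)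
    (hτ : ∀ w ∈ W, ∀ v ∈ τ.1, w + v ∈ W)
    (hmax : ∀ g : Q, 0 ≤ g → (∀ r : ℝ, 0 ≤ r → b + r • g ∈ W) → g ∈ τ.1) :
    Bornology.IsBounded (τ.coords s '' W) := by
  classical
  obtain ⟨t, ht⟩ := τ.relint_nonempty
  have htτ := Face.relint_subset ht
  by_contra hbd
  have hex : ∀ n : ℕ, ∃ w ∈ W, (n : ℝ) < ‖τ.coords s (w - b)‖ := by
    by_contra! hcon
    obtain ⟨n, hn⟩ := hcon
    refine hbd (isBounded_iff_forall_norm_le.2 ⟨n + ‖τ.coords s b‖, ?_⟩)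
    rintro _ ⟨w, hw, rfl⟩
    have h1 := hn w hw
    have h2 := norm_add_le (τ.coords s (w - b)) (τ.coords s b)
    rw [← map_add, sub_add_cancel] at h2
    linarith
  choose w hwW hw using hex
  set N : ℕ → ℝ := fun n => ‖τ.coords s (w n - b)‖ with hN
  have hNpos : ∀ n, 0 < N n := fun n => (Nat.cast_nonneg n).trans_lt (hw n)
  have hNtop : Tendsto N atTop atTop :=
    tendsto_atTop_mono (fun n => (hw n).le) tendsto_natCast_atTop_atTop
  have hx0 : ∀ n, ∀ l ∈ s, 0 ≤ l (w n - b) := fun n =>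
    (hs _).1 (sub_nonneg.2 (hb _ (hwW n)))
  let v : ℕ → (τ.vanishing s → ℝ) := fun n => τ.coords s ((N n)⁻¹ • (w n - b))
  have hv : ∀ n, v n ∈ Metric.sphere (0 : τ.vanishing s → ℝ) 1 := fun n => by
    change τ.coords s ((N n)⁻¹ • (w n - b)) ∈ _
    rw [mem_sphere_zero_iff_norm, map_smul, norm_smul, norm_inv, Real.norm_eq_abs,
      abs_of_pos (hNpos n)]
    exact inv_mul_cancel₀ (hNpos n).ne'
  obtain ⟨u, hu, φ, hφ, hlim⟩ := (isCompact_sphere (0 : τ.vanishing s → ℝ) 1).tendsto_subseq hv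
  obtain ⟨g₀, rfl⟩ : u ∈ LinearMap.range (τ.coords s) :=
    (τ.isClosed_range_coords s).mem_of_tendsto hlim (Eventually.of_forall fun n => ⟨_, rfl⟩)
  have hlim' : ∀ l : τ.vanishing s,
      Tendsto (fun n => (N (φ n))⁻¹ * l.1.1 (w (φ n) - b)) atTop (𝓝 (l.1.1 g₀)) := fun l => by
    have := (tendsto_pi_nhds.1 hlim) l
    simpa [v, Face.coords_apply] using this
  have hvan : ∀ l ∈ s, l t = 0 → ∀ x ∈ τ.1, l x = 0 := fun l hl h0 x hx =>
    Face.eq_zero_of_mem_relint hs ht hx hl h0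
  have hg₀ : ∀ l ∈ s, l t = 0 → 0 ≤ l g₀ := fun l hl h0 =>
    ge_of_tendsto' (hlim' ⟨⟨l, hl⟩, hvan l hl h0⟩) fun n =>
      mul_nonneg (inv_pos.2 (hNpos _)).le (hx0 _ l hl)
  -- The limit fixes `g₀` only through its coordinates; adding a multiple of `t` leaves these alone
  -- and makes the vector nonnegative.
  obtain ⟨r, hr⟩ := (eventually_nonneg_add_smul hs (Face.nonneg htτ) hg₀).exists
  have hmem : g₀ + r • t ∈ τ.1 := by
    refine hmax _ hr fun R hR => ?_
    -- Coordinates where `l g₀ > 0` tend to infinity along the sequence and overtake `R * l g₀`;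
    -- where `l g₀ = 0` there is nothing to overtake.
    have hev : ∀ᶠ n in atTop, ∀ l : τ.vanishing s,
        0 ≤ l.1.1 (w (φ n) - b - R • (g₀ + r • t)) := by
      rw [eventually_all]
      intro l
      have hlt : l.1.1 t = 0 := l.2 t htτ
      simp only [map_sub _ (_ - _), map_add, map_smul, smul_eq_mul, hlt, mul_zero, add_zero]
      rcases (hg₀ l.1.1 l.1.2 hlt).eq_or_lt with h0 | h0
      · filter_upwards with n
        rw [← h0, mul_zero, sub_zero]
        exact hx0 _ _ l.1.2
      · have htop := (hNtop.comp hφ.tendsto_atTop).atTop_mul_pos h0 (hlim' l)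
        filter_upwards [htop.eventually_ge_atTop (R * l.1.1 g₀)] with n hn
        rw [Function.comp_apply, ← mul_assoc, mul_inv_cancel₀ (hNpos _).ne', one_mul] at hn
        exact sub_nonneg.2 hn
    obtain ⟨n, hn⟩ := hev.exists
    -- The remaining functionals are positive at `t`, so translating along `τ`, which preserves `W`,
    -- takes care of them.
    obtain ⟨R', hR', hR0⟩ := ((eventually_nonneg_add_smul hs (Face.nonneg htτ)
      fun l hl h0 => hn ⟨⟨l, hl⟩, hvan l hl h0⟩).and (eventually_ge_atTop 0)).exists
    refine hW _ _ (hτ _ (hwW (φ n)) (R' • t) (PointedCone.smul_mem τ.1 hR0 htτ))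
      (le_add_of_nonneg_right (smul_nonneg hR hr)) ?_
    rw [← sub_nonneg]
    convert hR' using 1
    abel
  have h0 := Face.coords_eq_zero s hmem
  rw [map_add, map_smul, Face.coords_eq_zero s htτ, smul_zero, add_zero] at h0
  rw [h0, mem_sphere_zero_iff_norm, norm_zero] at hu
  exact zero_ne_one hu

/-- Modulo `τ` the closure of the image of `W` is compact, so the sum of the coordinates attains a
maximum there. The functionals are nonnegative on `Q₊`, so a step up from a maximizer must leave
each coordinate unchanged, hence lie in `τ`. -/
theorem Face.exists_maximal_mem_closure {τ : Face Q} {W : Set Q} {b : Q} (hbW : b ∈ W)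
    (hb : ∀ w ∈ W, b ≤ w) (hW : ∀ x, ∀ w ∈ W, b ≤ x → x ≤ w → x ∈ W)
    (hτ : ∀ w ∈ W, ∀ v ∈ τ.1, w + v ∈ W)
    (hmax : ∀ g : Q, 0 ≤ g → (∀ r : ℝ, 0 ≤ r → b + r • g ∈ W) → g ∈ τ.1) :
    ∃ (a : Q) (ha : 0 ≤ a - b), τ ≤ Face.generatedBy (a - b) ha ∧
      (∀ z ∈ (Face.generatedBy (a - b) ha).relint, z ≤ a - b → a - z ∈ W) ∧
      ∀ a', a ≤ a' → a' ∈ closure W → a' - a ∈ τ.1 := by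
  classical
  obtain ⟨s, hs⟩ := RealPolyhedralGroup.exists_halfspaces (Q := Q)
  obtain ⟨t, ht⟩ := τ.relint_nonempty
  have htτ := Face.relint_subset ht
  have hvan : ∀ l ∈ s, l t = 0 → ∀ x ∈ τ.1, l x = 0 := fun l hl h0 x hx =>
    Face.eq_zero_of_mem_relint hs ht hx hl h0
  have hcomp := (Face.isBounded_image_coords hs hb hW hτ hmax).isCompact_closure
  obtain ⟨v, hv, hvmax⟩ := hcomp.exists_isMaxOn ⟨_, subset_closure ⟨b, hbW, rfl⟩⟩
    (f := fun v : τ.vanishing s → ℝ => ∑ l, v l) (by fun_prop)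
  obtain ⟨a₀, rfl⟩ : v ∈ LinearMap.range (τ.coords s) :=
    closure_minimal (by rintro _ ⟨x, -, rfl⟩; exact ⟨x, rfl⟩) (τ.isClosed_range_coords s) hv
  obtain ⟨y, hy, hlim⟩ := mem_closure_iff_seq_limit.1 hv
  choose w hwW hw using hy
  have hlim' : ∀ l : τ.vanishing s,
      Tendsto (fun n => l.1.1 (w n)) atTop (𝓝 (l.1.1 a₀)) := fun l => by
    have := (tendsto_pi_nhds.1 hlim) l
    simpa [← hw, Face.coords_apply] using this
  have hwb : ∀ n, ∀ l ∈ s, 0 ≤ l (w n) - l b := fun n l hl => by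
    rw [← map_sub]
    exact (hs _).1 (sub_nonneg.2 (hb _ (hwW n))) l hl
  -- Only the coordinates of `a₀` matter, so it may be shifted along `t` until `a - b ≥ t`; this
  -- forces the face generated by `a - b` to contain `τ`.
  obtain ⟨r, hr⟩ := (eventually_nonneg_add_smul hs (t := t) (y := a₀ - b - t) (Face.nonneg htτ)
    fun l hl h0 => by
      rw [map_sub, map_sub, h0, sub_zero, sub_nonneg]
      exact ge_of_tendsto' (hlim' ⟨⟨l, hl⟩, hvan l hl h0⟩) fun n =>
        sub_nonneg.1 (hwb n l hl)).exists
  set a : Q := a₀ + r • t with ha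
  have hla : ∀ l : Module.Dual ℝ Q, l t = 0 → l a = l a₀ := fun l h0 => by simp [ha, h0]
  have hta : t ≤ a - b := by
    rw [← sub_nonneg]
    convert hr using 1
    rw [ha]
    abel
  have hab : 0 ≤ a - b := (Face.nonneg htτ).trans hta
  refine ⟨a, hab, ?_, ?_, ?_⟩
  · exact Face.le_generatedBy ht hab (Face.mem_of_le (Face.nonneg htτ) hta
      (Face.self_mem_generatedBy hab))
  · intro z hz hza
    have hz0 := (hs z).1 (Face.nonneg (Face.relint_subset hz))
    -- If `l z > 0`, then `l (a - z)` is strictly below the limit of `l (w n)`. If `l z = 0`, then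
    -- `l` vanishes on the generated face, so `l a = l b`, which is at most `l (w n)`.
    have hev : ∀ᶠ n in atTop, ∀ l : τ.vanishing s, 0 ≤ l.1.1 (w n - (a - z)) := by
      rw [eventually_all]
      intro l
      have hlt := hla l.1.1 (l.2 t htτ)
      rcases (hz0 l.1.1 l.1.2).eq_or_lt with h0 | h0
      · have h1 := Face.eq_zero_of_mem_relint hs hz (Face.self_mem_generatedBy hab) l.1.2 h0.symm
        filter_upwards with n
        have := hwb n l.1.1 l.1.2
        simp only [map_sub] at h1 ⊢
        linarith
      · filter_upwards [(hlim' l).eventually_const_lt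
          (show l.1.1 a₀ - l.1.1 z < l.1.1 a₀ by linarith)] with n hn
        simp only [map_sub]
        linarith
    obtain ⟨n, hn⟩ := hev.exists
    obtain ⟨R, hR, hR0⟩ := ((eventually_nonneg_add_smul hs (Face.nonneg htτ)
      fun l hl h0 => hn ⟨⟨l, hl⟩, hvan l hl h0⟩).and (eventually_ge_atTop 0)).exists
    refine hW _ _ (hτ _ (hwW n) (R • t) (PointedCone.smul_mem τ.1 hR0 htτ)) (le_sub_comm.1 hza) ?_
    rw [← sub_nonneg]
    convert hR using 1
    abel
  · intro a' haa' ha'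
    have hnn := (hs _).1 (sub_nonneg.2 haa')
    have hcont : Continuous (τ.coords s) := LinearMap.continuous_of_finiteDimensional _
    have hle : ∑ l, τ.coords s a' l ≤ ∑ l, τ.coords s a₀ l :=
      hvmax (image_closure_subset_closure_image hcont ⟨a', ha', rfl⟩)
    have hle' : ∑ l : τ.vanishing s, l.1.1 (a' - a) ≤ 0 := by
      simp only [map_sub, Finset.sum_sub_distrib, sub_nonpos]
      refine hle.trans (Finset.sum_le_sum fun l _ => ?_)
      rw [Face.coords_apply, hla _ (l.2 t htτ)]
    have hsum0 := (Finset.sum_eq_zero_iff_of_nonneg fun l _ => hnn l.1.1 l.1.2).1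
      (le_antisymm hle' (Finset.sum_nonneg fun l _ => hnn l.1.1 l.1.2))
    exact Face.mem_of_forall_eq_zero hs htτ (sub_nonneg.2 haa') fun l hl h0 =>
      hsum0 ⟨⟨l, hl⟩, hvan l hl h0⟩ (Finset.mem_univ _)

/-! ### Degrees and nadirs of cogenerators of a downset -/

/-- Above each degree `b` of a downset `D` there is a degree `a`, with faces `τ ≤ σ`, such that
`k[D]` has a cogenerator along `τ` with nadir `σ` in degree `a`. -/
theorem Face.exists_nadir (D : LowerSet Q) {b : Q} (hbD : b ∈ D) :
    ∃ (τ σ : Face Q) (a : Q), τ ≤ σ ∧ (∃ c ∈ σ.below a, b ≤ c) ∧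
      (∀ v ∈ τ.1, σ.below (a + v) ⊆ D) ∧
      ∀ (a' : Q) (ρ : Face Q), a ≤ a' → τ ≤ ρ → ρ ≤ σ → ρ.below a' ⊆ D →
        a' - a ∈ τ.1 ∧ ρ = σ := by
  let F : Q → Set (Face Q) := fun c => {τ | ∀ v ∈ τ.1, c + v ∈ D}
  have hFanti : ∀ {c d : Q}, c ≤ d → F d ⊆ F c := fun h τ hτ v hv =>
    D.lower (add_le_add_left h v) (hτ v hv)
  -- Minimality of `F b'` and antitonicity make `F` constant on the part of `D` above `b'`.
  obtain ⟨-, ⟨⟨b', hb', hb'D, rfl⟩, hmin⟩⟩ :=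
    (Set.toFinite {S | ∃ c, b ≤ c ∧ c ∈ D ∧ F c = S}).exists_minimal ⟨_, b, le_rfl, hbD, rfl⟩
  have hF : ∀ c, b' ≤ c → c ∈ D → F b' ⊆ F c := fun c hc hcD =>
    hmin ⟨c, hb'.trans hc, hcD, rfl⟩ (hFanti hc)
  have hne : (F b').Nonempty := by
    refine ⟨Face.generatedBy 0 le_rfl, ?_⟩
    rintro v ⟨hv0, r, -, hv⟩
    rw [smul_zero] at hv
    exact D.lower (add_le_of_nonpos_right hv) hb'D
  obtain ⟨τ, hτF, hτmax⟩ := (Set.toFinite (F b')).exists_maximal hne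
  obtain ⟨t, ht⟩ := τ.relint_nonempty
  let W : Set Q := {x | b' ≤ x ∧ x ∈ D}
  have hWτ : ∀ w ∈ W, ∀ v ∈ τ.1, w + v ∈ W := fun w hw v hv =>
    ⟨hw.1.trans (le_add_of_nonneg_right (Face.nonneg hv)), hF w hw.1 hw.2 hτF v hv⟩
  obtain ⟨a, ha, hτa, hrel, hamax⟩ := Face.exists_maximal_mem_closure (τ := τ) (W := W) (b := b')
    ⟨le_rfl, hb'D⟩ (fun w hw => hw.1) (fun x w hw h1 h2 => ⟨h1, D.lower h2 hw.2⟩) hWτ (by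
      intro g hg hgW
      have ht0 := Face.nonneg (Face.relint_subset ht)
      have htg : 0 ≤ t + g := add_nonneg ht0 hg
      have hself := Face.self_mem_generatedBy htg
      -- A ray in direction `g`, thickened by `τ`, puts the face generated by `t + g` into `F b'`;
      -- maximality of `τ` then forces `g ∈ τ`.
      refine hτmax (y := Face.generatedBy (t + g) htg) ?_ ?_
        (Face.mem_of_le hg (le_add_of_nonneg_left ht0) hself)
      · rintro x ⟨hx0, r, hr, hxr⟩
        refine D.lower ?_ (hWτ _ (hgW r hr.le) (r • t)
          (PointedCone.smul_mem τ.1 hr.le (Face.relint_subset ht))).2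
        rw [add_assoc, ← smul_add, add_comm g t]
        gcongr
      · exact Face.le_generatedBy ht htg (Face.mem_of_le ht0 (le_add_of_nonneg_right hg) hself))
  -- The face generated by `a - b'` itself qualifies, so a minimal choice exists. Staying inside it
  -- keeps suitable points of `a - σ°` above `b'`.
  obtain ⟨σ, ⟨hτσ, hσa, hσD⟩, hσmin⟩ :=
    (Set.toFinite {ρ : Face Q | τ ≤ ρ ∧ ρ ≤ Face.generatedBy (a - b') ha ∧
      ρ.below a ⊆ D}).exists_minimal ⟨_, hτa, le_rfl, fun c hc => by
        obtain ⟨z, hz, hzc, hza⟩ := Face.exists_mem_relint_le_of_le_generatedBy le_rfl hc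
        exact D.lower (le_sub_comm.1 hzc) (hrel z hz hza).2⟩
  have hmemW : ∀ z ∈ σ.relint, z ≤ a - b' → a - z ∈ W := fun z hz hza =>
    ⟨le_sub_comm.1 hza, hσD (by simpa [Face.below] using hz)⟩
  refine ⟨τ, σ, a, hτσ, ?_, ?_, ?_⟩
  · obtain ⟨y, hy⟩ := σ.relint_nonempty
    obtain ⟨z, hz, -, hza⟩ := Face.exists_mem_relint_le_of_le_generatedBy hσa hy
    exact ⟨a - z, by simpa [Face.below] using hz, hb'.trans (le_sub_comm.1 hza)⟩
  · intro v hv c hc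
    obtain ⟨z, hz, hzc, hza⟩ := Face.exists_mem_relint_le_of_le_generatedBy hσa hc
    refine D.lower ?_ (hWτ _ (hmemW z hz hza) v hv).2
    rw [sub_add_eq_add_sub]
    exact le_sub_comm.1 hzc
  · intro a' ρ haa' hτρ hρσ hρD
    -- The points `a' - z / (n + 1)` lie in `a' - ρ° ⊆ D`, remain above `b'` because `z ≤ a - b'`,
    -- and converge to `a'`.
    have hcl : a' ∈ closure W := by
      obtain ⟨y, hy⟩ := ρ.relint_nonempty
      obtain ⟨z, hz, -, hza⟩ :=
        Face.exists_mem_relint_le_of_le_generatedBy (hρσ.trans hσa) hy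
      have hz0 := Face.nonneg (Face.relint_subset hz)
      have hlim : Tendsto (fun n : ℕ => a' - (1 / ((n : ℝ) + 1)) • z) atTop (𝓝 a') := by
        simpa using (tendsto_const_nhds (x := a')).sub
          ((tendsto_one_div_add_atTop_nhds_zero_nat (𝕜 := ℝ)).smul_const z)
      refine mem_closure_of_tendsto hlim (Eventually.of_forall fun n => ⟨?_, hρD ?_⟩)
      · have h1 : (1 / ((n : ℝ) + 1)) • z ≤ z := by
          rw [← sub_nonneg]
          nth_rewrite 1 [← one_smul ℝ z]
          rw [← sub_smul]
          refine smul_nonneg (sub_nonneg.2 ?_) hz0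
          rw [div_le_one (by positivity)]
          linarith [Nat.cast_nonneg (α := ℝ) n]
        exact (le_sub_comm.1 (h1.trans hza)).trans (sub_le_sub_right haa' _)
      · simpa [Face.below] using Face.smul_mem_relint hz (by positivity : 0 < 1 / ((n : ℝ) + 1))
    refine ⟨hamax a' haa' hcl, le_antisymm hρσ (hσmin ⟨hτρ, hρσ.trans hσa, fun c hc => ?_⟩ hρσ)⟩
    -- Translating down by `a' - a` gives `a - ρ° ⊆ D`, so minimality of `σ` applies to `ρ`.
    refine D.lower (le_add_of_nonneg_right (sub_nonneg.2 haa'))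
      (hρD (show c + (a' - a) ∈ ρ.below a' from ?_))
    have : a' - (c + (a' - a)) = a - c := by abel
    simpa only [Face.below, Set.mem_ofPred_eq, this] using hc

end Faces

/-! ## Direct limits and socles -/

namespace PosetModule

/-! ### Exactness of directed limits -/

section Colimits

variable {k : Type*} [Field k] {P : Type*} [PartialOrder P]

theorem isDirectedOrder_coe {S : Set P} (hS : DirectedOn (· ≤ ·) S) : IsDirectedOrder S :=
  ⟨fun a b => by
    obtain ⟨c, hc, h1, h2⟩ := hS a a.2 b b.2
    exact ⟨⟨c, hc⟩, h1, h2⟩⟩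

theorem toColim_eq_zero_iff (M : PosetModule k P) {S : Set P} (hS : DirectedOn (· ≤ ·) S) {c : P}
    (hc : c ∈ S) (x : M.obj c) :
    M.toColim S hc x = 0 ↔ ∃ d ∈ S, ∃ h : c ≤ d, M.map h x = 0 := by
  classical
  have := isDirectedOrder_coe hS
  have : DirectedSystem (fun c : S => M.obj c)
      (fun c d (h : c ≤ d) => M.map (show (c : P) ≤ d from h)) :=
    ⟨fun c x => M.map_refl c x, fun _ _ _ h h' x => M.map_map h h' x⟩
  constructor
  · intro h
    obtain ⟨d, hd, h0⟩ := Module.DirectLimit.of.zero_exact (R := k) (ι := S)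
      (G := fun c : S => M.obj c) (i := ⟨c, hc⟩) h
    exact ⟨d, d.2, hd, h0⟩
  · rintro ⟨d, hd, h, h0⟩
    rw [← M.toColim_map S hc hd h, h0, map_zero]

theorem exists_toColim_eq (M : PosetModule k P) {S : Set P} (hS : DirectedOn (· ≤ ·) S)
    (hne : S.Nonempty) (z : M.Colim S) : ∃ (c : P) (hc : c ∈ S) (x : M.obj c),
      M.toColim S hc x = z := by
  classical
  have := isDirectedOrder_coe hS
  have := hne.to_subtype
  obtain ⟨c, x, h⟩ := Module.DirectLimit.exists_of z
  exact ⟨c, c.2, x, h⟩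

theorem Hom.colim_injective {M N : PosetModule k P} {φ : Hom M N} (hφ : φ.Injective) {S : Set P}
    (hS : DirectedOn (· ≤ ·) S) (hne : S.Nonempty) : Function.Injective (φ.colim S) := by
  rw [injective_iff_map_eq_zero]
  intro z hz
  obtain ⟨c, hc, x, rfl⟩ := M.exists_toColim_eq hS hne z
  rw [φ.colim_toColim, N.toColim_eq_zero_iff hS] at hz
  obtain ⟨d, hd, h, h0⟩ := hz
  rw [← φ.naturality] at h0
  exact (M.toColim_eq_zero_iff hS hc x).2 ⟨d, hd, h, hφ d (h0.trans (map_zero _).symm)⟩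

end Colimits


/-! ### Injectivity on socles and existence of cogenerators -/

section Socles

variable {k : Type*} [Field k] {P : Type*} [PartialOrder P]
  {Q : Type*} [NormedAddCommGroup Q] [NormedSpace ℝ Q] [PartialOrder Q] [RealPolyhedralGroup Q]

/-- Two degrees in one coset differ by `u - v` with `u, v ∈ τ`, so adding `u` to one and `v` to the
other makes them meet. -/
theorem directedOn_fiber (τ : Face Q) (α : Q ⧸ τ.span) (p : P) :
    DirectedOn (· ≤ ·) (fiber τ α p) := by
  rintro ⟨a, _⟩ ⟨ha, rfl⟩ ⟨a', p⟩ ⟨ha', rfl⟩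
  obtain ⟨u, hu, v, hv, huv⟩ :=
    Face.exists_sub_of_mem_span ((Submodule.Quotient.eq τ.span).1 (ha'.trans ha.symm))
  have hsum : a + u = a' + v := by
    have h : a' - a = u - v := huv
    rw [← sub_add_cancel a' a, h]
    abel
  refine ⟨(a + u, p), ⟨?_, rfl⟩, ⟨le_add_of_nonneg_right (Face.nonneg hu), le_rfl⟩, ?_, le_rfl⟩
  · rw [← ha]
    refine (Submodule.Quotient.eq τ.span).2 ?_
    rw [add_sub_cancel_left]
    exact Submodule.subset_span hu
  · exact hsum ▸ le_add_of_nonneg_right (Face.nonneg hv)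

theorem fiber_nonempty (τ : Face Q) (α : Q ⧸ τ.span) (p : P) : (fiber τ α p).Nonempty := by
  obtain ⟨a, rfl⟩ := Submodule.Quotient.mk_surjective _ α
  exact ⟨(a, p), rfl, rfl⟩

theorem Hom.upperBoundary_injective {M N : PosetModule k Q} {φ : Hom M N} (hφ : φ.Injective) :
    φ.upperBoundary.Injective := fun x =>
  Hom.colim_injective hφ ((OrderDual.ofDual x.2).directedOn_below x.1) (by
    obtain ⟨z, hz⟩ := (OrderDual.ofDual x.2).relint_nonempty
    exact ⟨x.1 - z, by simpa [Face.below] using hz⟩)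

theorem Hom.homSkyscraper_injective (τ : Face Q) {M N : PosetModule k (Q × P)} {φ : Hom M N}
    (hφ : φ.Injective) : (φ.homSkyscraper τ).Injective := fun x _ _ h =>
  Subtype.ext (hφ x (congrArg Subtype.val h))

theorem Hom.Injective.socleInjective {M N : PosetModule k Q} {φ : Hom M N} (hφ : φ.Injective)
    (τ : Face Q) : φ.SocleInjective τ := fun α σ =>
  Hom.colim_injective
    (Hom.homSkyscraper_injective τ fun x => Hom.upperBoundary_injective hφ (starInclusion τ x))
    (directedOn_fiber τ α σ) (fiber_nonempty τ α σ)

/-- An element that divides a cogenerator is not killed by a homomorphism that is injective on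
the socle. -/
theorem IsCogenerator.app_ne_zero {M N : PosetModule k Q} {φ : Hom M N} {τ : Face Q}
    (hφ : φ.SocleInjective τ) {a : Q} {σ : OpenStar τ} {s : (M.upperBoundaryAlong τ).obj (a, σ)}
    (hs : M.IsCogenerator s) {b : Q} {y : M.obj b} (hy : M.Divides y s) : φ.app b y ≠ 0 := by
  obtain ⟨hsoc, hne⟩ := hs
  obtain ⟨c, hc, hbc, rfl⟩ := hy
  intro h0
  refine hne (hφ (Submodule.Quotient.mk a) σ ?_)
  rw [map_zero]
  refine (Hom.colim_toColim _ _ _ _).trans ((congrArg _ (Subtype.ext ?_)).trans (map_zero _))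
  change φ.colim (σ.face.below a) (M.toColim (σ.face.below a) hc (M.map hbc y)) = 0
  rw [Hom.colim_toColim, φ.naturality, h0, map_zero, map_zero]

/-- If a homogeneous element `y` survives exactly in the degrees of a downset `D`, then its image
in the direct limit atop `σ` at `a` vanishes exactly when `a - σ°` is not contained in `D`. -/
theorem toColim_map_eq_zero_iff (M : PosetModule k Q) {b : Q} (y : M.obj b) {D : LowerSet Q}
    (hD : ∀ c (h : b ≤ c), M.map h y = 0 ↔ c ∉ D) {σ : Face Q} {a c : Q} (hc : c ∈ σ.below a)
    (h : b ≤ c) :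
    M.toColim (σ.below a) hc (M.map h y) = 0 ↔ ¬ (σ.below a ⊆ D) := by
  rw [M.toColim_eq_zero_iff (σ.directedOn_below a), Set.not_subset]
  constructor
  · rintro ⟨d, hd, hcd, h0⟩
    rw [M.map_map, hD] at h0
    exact ⟨d, hd, h0⟩
  · rintro ⟨d, hd, hdD⟩
    obtain ⟨e, he, hce, hde⟩ := σ.directedOn_below a c hc d hd
    refine ⟨e, he, hce, ?_⟩
    rw [M.map_map, hD]
    exact fun heD => hdD (D.lower hde heD)

/-- In `⨁ k[D_j]` the `j`-th component of `y`, when nonzero, survives exactly on `D_j`, so `D` is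
the union of the `D_j` over the nonzero components. -/
theorem DownsetFinite.exists_lowerSet {M : PosetModule k P} (hM : M.DownsetFinite) {b : P}
    (y : M.obj b) : ∃ D : LowerSet P, ∀ c (h : b ≤ c), M.map h y = 0 ↔ c ∉ D := by
  obtain ⟨n, D, ι, hι⟩ := hM
  refine ⟨⨆ j ∈ {j | ι.app b y j ≠ 0}, D j, fun c h => ?_⟩
  rw [← map_eq_zero_iff _ (hι c), ι.naturality]
  simp only [LowerSet.mem_iSup_iff, Set.mem_ofPred_eq, not_exists]
  constructor
  · intro h0 j hj hcj
    refine hj (funext fun hb => ?_)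
    exact congrFun (congrFun h0 j) ⟨hcj⟩
  · intro h0
    refine funext fun j => funext fun hcj => ?_
    by_contra hne
    refine h0 j (fun hj => hne ?_) hcj.down
    change ι.app b y j ⟨(D j).lower h hcj.down⟩ = 0
    rw [hj]
    rfl

/-- Above `b` the element `y` behaves like a generator of `k[D]`, so the degree and faces found for
`D` serve for `M`. -/
theorem DownsetFinite.exists_divides_isCogenerator {M : PosetModule k Q} (hM : M.DownsetFinite)
    {b : Q} {y : M.obj b} (hy : y ≠ 0) :
    ∃ (τ : Face Q) (σ : OpenStar τ) (a : Q) (s : (M.upperBoundaryAlong τ).obj (a, σ)),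
      M.IsCogenerator s ∧ M.Divides y s := by
  obtain ⟨D, hD⟩ := hM.exists_lowerSet y
  have hbD : b ∈ D := by
    by_contra hb
    exact hy (by rw [← M.map_refl b y, hD b le_rfl]; exact hb)
  obtain ⟨τ, σ, a, hτσ, ⟨c, hc, hbc⟩, htrans, hmax⟩ := Face.exists_nadir D hbD
  have hmap : ∀ (x : Q × OpenStar τ) (h : (a, OpenStar.mk σ hτσ) ≤ x),
      (M.upperBoundaryAlong τ).map h (M.toColim (σ.below a) hc (M.map hbc y)) = 0 ↔
        ¬ (x.2.face.below x.1 ⊆ D) := by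
    intro x h
    obtain ⟨d, hd, hcd⟩ := Face.exists_below_le (ρ := x.2.face) h.2 h.1 hc
    rw [← M.toColim_map_eq_zero_iff y hD hd (hbc.trans hcd), ← M.map_map hbc hcd]
    refine Eq.congr_left ?_
    exact M.colimMap_toColim (x.2.face.directedOn_below x.1) _ hc hd hcd _
  refine ⟨τ, OpenStar.mk σ hτσ, a, M.toColim (σ.below a) hc (M.map hbc y), ⟨?_, ?_⟩,
    c, hc, hbc, rfl⟩
  -- By maximality, an image that survives must lie over `a + τ` and the same `σ`; all other images
  -- vanish.
  · refine (exists_hom_skyscraper_iff τ (M.upperBoundaryAlong τ) (a, OpenStar.mk σ hτσ) _).2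
      fun x h hx => (hmap x h).2 fun hsub => hx ?_
    obtain ⟨h1, h2⟩ := hmax x.1 x.2.face h.1 (OrderDual.ofDual x.2).2 h.2 hsub
    exact ⟨h1, OrderDual.ofDual.injective (Subtype.ext h2)⟩
  -- A zero class in the socle would mean vanishing at some `a' ≥ a` in the coset of `a`, that is
  -- with `a' - a ∈ τ`, but `a' - σ° ⊆ D` there.
  · intro hzero
    obtain ⟨⟨a', p⟩, ⟨ha', rfl⟩, h, h0⟩ :=
      (toColim_eq_zero_iff _ (directedOn_fiber τ _ _) _ _).1 hzero
    refine (hmap _ h).1 (congrArg Subtype.val h0) ?_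
    have hmem : a' - a ∈ τ.1 :=
      Face.mem_of_mem_span ((Submodule.Quotient.eq τ.span).1 ha') (sub_nonneg.2 h.1)
    have h := htrans _ hmem
    rwa [add_sub_cancel] at h

end Socles

end PosetModule

end
theorem theorem5p5 {k : Type*} [Field k]
    {Q : Type*} [NormedAddCommGroup Q] [NormedSpace ℝ Q] [PartialOrder Q] [RealPolyhedralGroup Q]
    (M N : PosetModule k Q) (φ : PosetModule.Hom M N) :
    (φ.Injective → ∀ τ : Face Q, φ.SocleInjective τ) ∧
    (M.DownsetFinite → (∀ τ : Face Q, φ.SocleInjective τ) → φ.Injective) ∧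
    (M.DownsetFinite → ∀ (b : Q) (y : M.obj b), y ≠ 0 →
      ∃ (τ : Face Q) (σ : OpenStar τ) (a : Q) (s : (M.upperBoundaryAlong τ).obj (a, σ)),
        M.IsCogenerator s ∧ M.Divides y s) := by
  refine ⟨fun h τ => h.socleInjective τ, fun hM h b => ?_, fun hM b y hy =>
    hM.exists_divides_isCogenerator hy⟩
  rw [injective_iff_map_eq_zero]
  intro y hy
  by_contra hne
  obtain ⟨τ, σ, a, s, hs, hys⟩ := hM.exists_divides_isCogenerator hne
  exact hs.app_ne_zero (h τ) hys hy
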